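/- Let $A$ be a $d\times n$ integer matrix with columns $a_1,\dots,a_n$, and suppose that there is $l\in\mathbb{R}^d$ with $\langle l,a_j\rangle<0$ for all $j$. Let $\Lambda\subseteq\mathbb{Z}^n$ be a lattice (an additive subgroup, of any rank) with $A\lambda=0$ for all $\lambda\in\Lambda$. For vectors, $x<y$ means $x_i<y_i$ for all $i$, $x\le y$ means $x_i\le y_i$ for all $i$, and $\max$ is taken coordinate-wise. Call $\Lambda$ generic if, whenever a nonzero $\lambda\in\Lambda$ has $\lambda_i=0$ for some $i$, there is $\lambda'\in\Lambda$ with $\lambda'<\max(\lambda,0)$. Call $\varphi:\Lambda\to\mathbb{R}^n$ a proper perturbation if, for all $x,y\in\Lambda$ and all $i$: (1) if $x\neq y$ then $\varphi(x)_i\ne\varphi(y)_i$; (2) if $\varphi(x)_i<\varphi(y)_i$ then $x_i\le y_i$; (3) if $\varphi(x)_i<\varphi(y)_i$ then $\varphi(x+\lambda)_i<\varphi(y+\lambda)_i$ for all $\lambda\in\Lambda$. Let $S$ be a neighborhood complex of $\Lambda$, that is, one of the following simplicial complexes of nonempty finite subsets of $\Lambda$: (a) $\Lambda$ is generic, and $s\in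 S$ if and only if there is no $\lambda\in\Lambda$ with $\lambda<\max(s)$; or (b) $\Lambda$ is arbitrary, $\varphi$ is a proper perturbation, and $s\in S$ if and only if there is no $\lambda\in\Lambda$ with $\varphi(\lambda)<\max(\varphi(s))$. For $\xi\in\mathbb{Z}^n$ let $S_\xi=\{s\in S:\max(s)\le\xi\}$. Then $S_\xi$ is finite, and if $S_\xi\neq\emptyset$, its Euler characteristic is $$\mathrm{EC}(S_\xi)=\sum_{s\in S_\xi}(-1)^{\dim(s)}=1,\qquad \dim(s)=|s|-1.$$ -/

import Mathlib

namespace Neighborhood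

/-- The coordinate-wise maximum `max (ψ v₁, …, ψ vₖ)` of the positions of the vertices of a nonempty
finite set `s = {v₁, …, vₖ}`; suprema in `Fin n → R` are taken coordinate by coordinate. -/
def coordMax {V R : Type*} [LinearOrder R] {n : ℕ} (ψ : V → Fin n → R)
    (s : Finset V) (hs : s.Nonempty) : Fin n → R :=
  s.sup' hs ψ

theorem coordMax_mono {V R : Type*} [LinearOrder R] {n : ℕ} (ψ : V → Fin n → R)
    {s t : Finset V} (hs : s.Nonempty) (ht : t.Nonempty) (h : s ⊆ t) :
    coordMax ψ s hs ≤ coordMax ψ t ht :=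
  Finset.sup'_mono ψ h hs

/-- The complex on the vertex set `V` determined by positions `ψ : V → Rⁿ`: a nonempty finite set
`s` of vertices is a face if and only if no vertex lies strictly below `max (ψ s)` in every
coordinate. (`StrongLT x y` means `x i < y i` for all `i`.) -/
def complexOf {V R : Type*} [LinearOrder R] {n : ℕ} (ψ : V → Fin n → R) :
    PreAbstractSimplicialComplex V where
  faces := {s | ∃ hs : s.Nonempty, ¬ ∃ v : V, StrongLT (ψ v) (coordMax ψ s hs)}
  isRelLowerSet_faces := by
    rintro s ⟨hs, h⟩
    refine ⟨hs, fun t hts ht => ⟨ht, ?_⟩⟩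
    rintro ⟨v, hv⟩
    exact h ⟨v, fun i => lt_of_lt_of_le (hv i) (coordMax_mono ψ ht hs hts i)⟩

/-- The inclusion of a lattice `Λ ⊆ ℤⁿ` in `ℤⁿ`. -/
def incl {n : ℕ} (Λ : AddSubgroup (Fin n → ℤ)) : Λ → Fin n → ℤ := fun v => v

/-- A lattice is generic if for every nonzero `v ∈ Λ` with some coordinate equal to `0` there is
`w ∈ Λ` which is strictly below `max (v, 0)` in every coordinate. -/
def IsGeneric {n : ℕ} (Λ : AddSubgroup (Fin n → ℤ)) : Prop :=
  ∀ v ∈ Λ, v ≠ 0 → (∃ i, v i = 0) → ∃ w ∈ Λ, StrongLT w (v ⊔ 0)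

/-- Proper perturbations `φ : Λ → ℝⁿ`. -/
structure IsProperPerturbation {n : ℕ} (Λ : AddSubgroup (Fin n → ℤ))
    (φ : Λ → Fin n → ℝ) : Prop where
  coord_ne : ∀ x y : Λ, x ≠ y → ∀ i, φ x i ≠ φ y i
  le_of_lt : ∀ (x y : Λ) (i : Fin n), φ x i < φ y i → (x : Fin n → ℤ) i ≤ (y : Fin n → ℤ) i
  translate : ∀ (x y : Λ) (i : Fin n), φ x i < φ y i → ∀ v : Λ, φ (x + v) i < φ (y + v) i

/-- The neighborhood complex of a generic lattice `Λ`. -/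
def neighborhoodComplex {n : ℕ} (Λ : AddSubgroup (Fin n → ℤ)) : PreAbstractSimplicialComplex Λ :=
  complexOf (incl Λ)

/-- The neighborhood complex of a lattice `Λ` with respect to a proper perturbation `φ`. -/
noncomputable def perturbedNeighborhoodComplex {n : ℕ} (Λ : AddSubgroup (Fin n → ℤ)) (φ : Λ → Fin n → ℝ) :
    PreAbstractSimplicialComplex Λ :=
  complexOf φ

/-- The subcomplex `S_ξ` of all faces `s ∈ S` with `max (s) ≤ ξ`, where the maximum is that of the
(unperturbed) lattice points. -/
def subcomplexLE {n : ℕ} {Λ : AddSubgroup (Fin n → ℤ)} (S : PreAbstractSimplicialComplex Λ)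
    (ξ : Fin n → ℤ) : PreAbstractSimplicialComplex Λ where
  faces := {s | s ∈ S.faces ∧ ∃ hs : s.Nonempty, coordMax (incl Λ) s hs ≤ ξ}
  isRelLowerSet_faces := by
    rintro s ⟨hS, hs, h⟩
    refine ⟨hs, fun t hts ht => ⟨((S.isRelLowerSet_faces hS).2 hts ht), ht, ?_⟩⟩
    exact (coordMax_mono _ ht hs hts).trans h

/-- The Euler characteristic `∑ (-1) ^ dim s` over the faces of a finite complex, where
`dim s = |s| - 1` (faces are nonempty). -/
noncomputable def eulerChar {V : Type*} (K : PreAbstractSimplicialComplex V) : ℤ :=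
  ∑ᶠ s ∈ K.faces, (-1 : ℤ) ^ (s.card - 1)

end Neighborhood

/-! Let `W` be the set of lattice points `≤ ξ`. It is finite because a strictly positive linear form
vanishes on `Λ`, and `S_ξ` consists of the faces contained in `W`. Over all nonempty subsets of `W`
the signs `(-1) ^ |s|` sum to `-1`, so it suffices that the non-faces cancel
(`sum_nonfaces_eq_zero`). A non-face has a vertex strictly below its maximum; choose one as a
function of the maximum alone. Toggling it in `s` preserves the maximum, hence is a sign-reversing
involution on non-faces, and it stays inside `W`. -/

namespace Neighborhood

section General

variable {V R : Type*} [LinearOrder R] {n : ℕ}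

theorem coordMax_insert_of_strongLT [DecidableEq V] (ψ : V → Fin n → R) {s : Finset V}
    (hs : s.Nonempty) {v : V} (hv : StrongLT (ψ v) (coordMax ψ s hs)) :
    coordMax ψ (insert v s) (Finset.insert_nonempty v s) = coordMax ψ s hs := by
  unfold coordMax at *
  rw [Finset.sup'_insert hs]
  exact sup_eq_right.2 hv.le

/-- If `s = {v}`, then `ψ v` would lie strictly below itself; with `n = 0` this is no contradiction.
-/
theorem erase_nonempty_of_strongLT [DecidableEq V] (hn : n ≠ 0) (ψ : V → Fin n → R)
    {s : Finset V} (hs : s.Nonempty) {v : V} (hv : StrongLT (ψ v) (coordMax ψ s hs)) :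
    (s.erase v).Nonempty := by
  rw [Finset.nonempty_iff_ne_empty]
  intro h
  rcases (Finset.erase_eq_empty_iff _ _).1 h with rfl | rfl
  · exact Finset.not_nonempty_empty hs
  · exact lt_irrefl _ (hv ⟨0, Nat.pos_of_ne_zero hn⟩)

/-- In no coordinate does `v` attain the maximum, so the other vertices attain it. -/
theorem coordMax_erase_of_strongLT [DecidableEq V] (ψ : V → Fin n → R) {s : Finset V}
    (hs : s.Nonempty) {v : V} (hv : StrongLT (ψ v) (coordMax ψ s hs))
    (he : (s.erase v).Nonempty) :
    coordMax ψ (s.erase v) he = coordMax ψ s hs := by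
  by_cases hvs : v ∈ s
  · have h : coordMax ψ s hs = ψ v ⊔ coordMax ψ (s.erase v) he := by
      unfold coordMax
      rw [← Finset.sup'_insert he]
      congr 1
      exact (Finset.insert_erase hvs).symm
    funext i
    have hi := hv i
    rw [h, Pi.sup_apply] at hi ⊢
    rcases lt_sup_iff.1 hi with hlt | hlt
    · exact absurd hlt (lt_irrefl _)
    · exact (sup_eq_right.2 hlt.le).symm
  · congr 1
    exact Finset.erase_eq_of_notMem hvs

theorem symmDiff_singleton_eq [DecidableEq V] (s : Finset V) (v : V) :
    symmDiff s {v} = if v ∈ s then s.erase v else insert v s := by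
  ext x
  by_cases hx : x = v <;> split_ifs <;> simp_all [Finset.mem_symmDiff]

/-- Adding or removing a vertex strictly below the coordinate-wise maximum does not change the
maximum. -/
theorem coordMax_symmDiff_of_strongLT [DecidableEq V] (hn : n ≠ 0) (ψ : V → Fin n → R)
    {s : Finset V} (hs : s.Nonempty) {v : V} (hv : StrongLT (ψ v) (coordMax ψ s hs)) :
    ∃ h : (symmDiff s {v}).Nonempty, coordMax ψ (symmDiff s {v}) h = coordMax ψ s hs := by
  by_cases h : v ∈ s
  · rw [(symmDiff_singleton_eq s v).trans (if_pos h)]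
    exact ⟨erase_nonempty_of_strongLT hn ψ hs hv, coordMax_erase_of_strongLT ψ hs hv _⟩
  · rw [(symmDiff_singleton_eq s v).trans (if_neg h)]
    exact ⟨_, coordMax_insert_of_strongLT ψ hs hv⟩

theorem neg_one_pow_card_symmDiff_singleton [DecidableEq V] (s : Finset V) (v : V) :
    (-1 : ℤ) ^ (symmDiff s {v}).card = -(-1) ^ s.card := by
  rw [symmDiff_singleton_eq]
  split_ifs with h
  · rw [← Finset.card_erase_add_one h, pow_succ]
    ring
  · rw [Finset.card_insert_of_notMem h, pow_succ]
    ring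

theorem mem_complexOf_faces (ψ : V → Fin n → R) {s : Finset V} (hs : s.Nonempty) :
    s ∈ (complexOf ψ).faces ↔ ¬ ∃ v, StrongLT (ψ v) (coordMax ψ s hs) :=
  ⟨fun ⟨_, h⟩ => h, fun h => ⟨hs, h⟩⟩

open Classical in
/-- The nonempty subsets of `W` that are not faces cancel in pairs. -/
theorem sum_nonfaces_eq_zero (hn : n ≠ 0) (ψ : V → Fin n → R) (W : Finset V)
    (hW : ∀ s ⊆ W, ∀ hs : s.Nonempty, ∀ v, StrongLT (ψ v) (coordMax ψ s hs) → v ∈ W) :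
    ∑ s ∈ W.powerset.erase ∅ with s ∉ (complexOf ψ).faces, (-1 : ℤ) ^ s.card = 0 := by
  rcases isEmpty_or_nonempty V with hV | hV
  · refine Finset.sum_eq_zero fun s hs => ?_
    simp only [Finset.mem_filter, Finset.mem_erase] at hs
    exact absurd (Finset.eq_empty_of_isEmpty s) hs.1.1
  have hc : ∀ m : Fin n → R, ∃ v, (∃ w, StrongLT (ψ w) m) → StrongLT (ψ v) m := fun m => by
    by_cases h : ∃ w, StrongLT (ψ w) m
    · exact ⟨h.choose, fun _ => h.choose_spec⟩
    · exact ⟨Classical.arbitrary V, fun h' => absurd h' h⟩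
  -- `c` depends only on the maximum `m`, so `s` and its toggled set get the same vertex, which
  -- makes the toggle an involution.
  choose c hc using hc
  have key : ∀ s ∈ (W.powerset.erase ∅).filter (· ∉ (complexOf ψ).faces),
      ∃ hs : s.Nonempty, s ⊆ W ∧ StrongLT (ψ (c (coordMax ψ s hs))) (coordMax ψ s hs) := by
    intro s hs
    simp only [Finset.mem_filter, Finset.mem_erase, Finset.mem_powerset] at hs
    have hne := Finset.nonempty_iff_ne_empty.2 hs.1.1
    rw [mem_complexOf_faces ψ hne, not_not] at hs
    exact ⟨hne, hs.1.2, hc _ hs.2⟩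
  refine Finset.sum_involution
    (fun s hs => symmDiff s {c (coordMax ψ s (key s hs).1)}) ?_ ?_ ?_ ?_
  · intro s hs
    rw [neg_one_pow_card_symmDiff_singleton, add_neg_cancel]
  · intro s hs _ h
    have := neg_one_pow_card_symmDiff_singleton s (c (coordMax ψ s (key s hs).1))
    rw [h] at this
    exact pow_ne_zero s.card (by norm_num : (-1 : ℤ) ≠ 0) (by linarith)
  · intro s hs
    obtain ⟨hne, hsW, hlt⟩ := key s hs
    obtain ⟨h, heq⟩ := coordMax_symmDiff_of_strongLT hn ψ hne hlt
    simp only [Finset.mem_filter, Finset.mem_erase, Finset.mem_powerset]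
    refine ⟨⟨h.ne_empty, ?_⟩, ?_⟩
    · refine (symmDiff_le_sup (a := s)).trans (Finset.union_subset hsW ?_)
      exact Finset.singleton_subset_iff.2 (hW s hsW hne _ hlt)
    · rw [mem_complexOf_faces ψ h, heq, not_not]
      exact ⟨_, hlt⟩
  · intro s hs
    obtain ⟨hne, hsW, hlt⟩ := key s hs
    obtain ⟨h, heq⟩ := coordMax_symmDiff_of_strongLT hn ψ hne hlt
    simp only [heq, symmDiff_symmDiff_cancel_right]

theorem sum_nonempty_powerset_neg_one_pow_card [DecidableEq V] {W : Finset V}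
    (hW : W.Nonempty) : ∑ s ∈ W.powerset.erase ∅, (-1 : ℤ) ^ s.card = -1 := by
  have h := Finset.sum_powerset_neg_one_pow_card_of_nonempty hW
  rw [← Finset.add_sum_erase _ _ (Finset.empty_mem_powerset W)] at h
  simp only [Finset.card_empty, pow_zero] at h
  linarith

/-- If a nonempty finite set `W` of vertices contains every vertex strictly below the maximum of
some subset of `W`, then the faces contained in `W` form a complex of Euler characteristic `1`. -/
theorem eulerChar_eq_one (hn : n ≠ 0) (ψ : V → Fin n → R) (W : Finset V) (hne : W.Nonempty)
    (hW : ∀ s ⊆ W, ∀ hs : s.Nonempty, ∀ v, StrongLT (ψ v) (coordMax ψ s hs) → v ∈ W)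
    (K : PreAbstractSimplicialComplex V)
    (hK : ∀ s, s ∈ K.faces ↔ s ∈ (complexOf ψ).faces ∧ s ⊆ W) :
    eulerChar K = 1 := by
  classical
  have hfaces : K.faces =
      ↑((W.powerset.erase ∅).filter (· ∈ (complexOf ψ).faces)) := by
    ext s
    simp only [hK, Finset.coe_filter, Set.mem_ofPred_eq, Finset.mem_erase, Finset.mem_powerset]
    exact ⟨fun h => ⟨⟨h.1.1.ne_empty, h.2⟩, h.1⟩, fun h => ⟨h.2, h.1.2⟩⟩
  have hsum := Finset.sum_filter_add_sum_filter_not (W.powerset.erase ∅)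
    (· ∈ (complexOf ψ).faces) (fun s => (-1 : ℤ) ^ s.card)
  rw [sum_nonfaces_eq_zero hn ψ W hW, sum_nonempty_powerset_neg_one_pow_card hne,
    add_zero] at hsum
  unfold eulerChar
  -- Negate both sides: `(-1) ^ dim s = -(-1) ^ |s|` for nonempty `s`.
  rw [hfaces, finsum_mem_coe_finset, ← neg_inj]
  refine Eq.trans ?_ hsum
  rw [← Finset.sum_neg_distrib]
  refine Finset.sum_congr rfl fun s hs => ?_
  simp only [Finset.mem_filter, Finset.mem_erase] at hs
  obtain ⟨k, hk⟩ := Nat.exists_eq_succ_of_ne_zero (Finset.card_ne_zero.2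
    (Finset.nonempty_iff_ne_empty.2 hs.1.1))
  rw [hk, Nat.succ_sub_one, Nat.succ_eq_add_one, pow_succ]
  ring

end General

/-- Only finitely many points of `Λ` lie below `ξ`. -/
theorem finite_setOf_le {d n : ℕ} (A : Matrix (Fin d) (Fin n) ℤ)
    (hA : ∃ l : Fin d → ℝ, ∀ j : Fin n, ∑ i, l i * (A i j : ℝ) < 0)
    (Λ : AddSubgroup (Fin n → ℤ)) (hΛ : ∀ v ∈ Λ, A.mulVec v = 0) (ξ : Fin n → ℤ) :
    {v : Λ | incl Λ v ≤ ξ}.Finite := by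
  obtain ⟨l, hl⟩ := hA
  -- The row vector `-lA`: positive in each entry and orthogonal to `Λ`.
  set c : Fin n → ℝ := fun j => -∑ i, l i * (A i j : ℝ) with hc
  have hpos : ∀ j, 0 < c j := fun j => neg_pos.2 (hl j)
  have hzero : ∀ v ∈ Λ, ∑ j, c j * (v j : ℝ) = 0 := by
    intro v hv
    have hrow : ∀ i, ∑ j, (A i j : ℝ) * (v j : ℝ) = 0 := fun i => by
      exact_mod_cast congrFun (hΛ v hv) i
    have : ∑ j, c j * (v j : ℝ) = -∑ i, l i * ∑ j, (A i j : ℝ) * (v j : ℝ) := by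
      simp only [hc, neg_mul, Finset.sum_mul, Finset.mul_sum, Finset.sum_neg_distrib]
      rw [Finset.sum_comm]
      simp only [mul_assoc]
    simp [this, hrow]
  -- For `v ≤ ξ` the terms `c k * (ξ k - v k)` are nonnegative with sum `∑ k, c k * ξ k`; bounding
  -- the `j`-th term by this sum bounds `v j` from below.
  set B : Fin n → ℤ := fun j => ⌊ξ j - (∑ k, c k * (ξ k : ℝ)) / c j⌋ with hB
  refine Set.Finite.of_finite_image (f := incl Λ) ((Set.finite_Icc B ξ).subset ?_)
    Subtype.val_injective.injOn
  rintro _ ⟨v, hv, rfl⟩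
  refine ⟨fun j => ?_, hv⟩
  have hterm : c j * ((ξ j : ℝ) - (v.1 j : ℝ)) ≤ ∑ k, c k * ((ξ k : ℝ) - (v.1 k : ℝ)) :=
    Finset.single_le_sum (f := fun k => c k * ((ξ k : ℝ) - (v.1 k : ℝ)))
      (fun k _ => mul_nonneg (hpos k).le (sub_nonneg.2 (Int.cast_le.2 (hv k))))
      (Finset.mem_univ j)
  simp only [mul_sub, Finset.sum_sub_distrib, hzero v.1 v.2, sub_zero] at hterm
  rw [← mul_sub, mul_comm, ← le_div_iff₀ (hpos j)] at hterm
  have hle : (ξ j : ℝ) - (∑ k, c k * (ξ k : ℝ)) / c j ≤ (v.1 j : ℝ) := by linarith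
  exact Int.cast_le.1 ((Int.floor_le _).trans hle)

/-- The common form of both cases: a position map `ψ` of the lattice that respects the order of
`Λ` in each coordinate. -/
theorem finite_and_eulerChar_subcomplexLE {n : ℕ} {R : Type*} [LinearOrder R]
    (Λ : AddSubgroup (Fin n → ℤ)) (ψ : Λ → Fin n → R)
    (hψ : ∀ (x y : Λ) (i : Fin n), ψ x i < ψ y i → incl Λ x i ≤ incl Λ y i)
    (ξ : Fin n → ℤ) (hfin : {v : Λ | incl Λ v ≤ ξ}.Finite) :
    (subcomplexLE (complexOf ψ) ξ).faces.Finite ∧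
      ((subcomplexLE (complexOf ψ) ξ).faces.Nonempty →
        eulerChar (subcomplexLE (complexOf ψ) ξ) = 1) := by
  have hK : ∀ s, s ∈ (subcomplexLE (complexOf ψ) ξ).faces ↔
      s ∈ (complexOf ψ).faces ∧ s ⊆ hfin.toFinset := by
    intro s
    refine and_congr_right fun hs => ?_
    simp only [coordMax, Finset.sup'_le_iff, Finset.subset_iff, Set.Finite.mem_toFinset,
      Set.mem_ofPred_eq]
    exact ⟨fun h => h.2, fun h => ⟨hs.1, h⟩⟩
  refine ⟨(hfin.toFinset.powerset.finite_toSet).subset fun s hs =>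
    Finset.mem_coe.2 (Finset.mem_powerset.2 ((hK s).1 hs).2), ?_⟩
  rintro ⟨t, ht⟩
  obtain ⟨⟨htne, htface⟩, htW⟩ := (hK t).1 ht
  refine eulerChar_eq_one ?_ ψ hfin.toFinset (htne.mono htW) ?_ _ hK
  -- For `n = 0`, `StrongLT` holds vacuously, so there are no faces.
  · rintro rfl
    exact htface ⟨0, fun i => i.elim0⟩
  · intro s hsW hs v hv
    rw [Set.Finite.mem_toFinset]
    intro i
    -- In each coordinate `v` lies below some `w ∈ s`, which may vary with `i`; `hψ` carries this
    -- over to the lattice points.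
    have hi := hv i
    rw [coordMax, Finset.sup'_apply, Finset.lt_sup'_iff] at hi
    obtain ⟨w, hw, hlt⟩ := hi
    have hwξ : incl Λ w ≤ ξ := (Set.Finite.mem_toFinset hfin).1 (hsW hw)
    exact (hψ v w i hlt).trans (hwξ i)

end Neighborhood

theorem mainTheorem4 {d n : ℕ} (A : Matrix (Fin d) (Fin n) ℤ)
    (hA : ∃ l : Fin d → ℝ, ∀ j : Fin n, ∑ i, l i * (A i j : ℝ) < 0)
    (Λ : AddSubgroup (Fin n → ℤ)) (hΛ : ∀ v ∈ Λ, A.mulVec v = 0) :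
    (Neighborhood.IsGeneric Λ → ∀ ξ : Fin n → ℤ,
      (Neighborhood.subcomplexLE (Neighborhood.neighborhoodComplex Λ) ξ).faces.Finite ∧
      ((Neighborhood.subcomplexLE (Neighborhood.neighborhoodComplex Λ) ξ).faces.Nonempty →
        Neighborhood.eulerChar
          (Neighborhood.subcomplexLE (Neighborhood.neighborhoodComplex Λ) ξ) = 1)) ∧
    (∀ φ : Λ → Fin n → ℝ, Neighborhood.IsProperPerturbation Λ φ → ∀ ξ : Fin n → ℤ,
      (Neighborhood.subcomplexLE (Neighborhood.perturbedNeighborhoodComplex Λ φ) ξ).faces.Finite ∧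
      ((Neighborhood.subcomplexLE
          (Neighborhood.perturbedNeighborhoodComplex Λ φ) ξ).faces.Nonempty →
        Neighborhood.eulerChar
          (Neighborhood.subcomplexLE (Neighborhood.perturbedNeighborhoodComplex Λ φ) ξ) = 1)) :=
  ⟨fun _ ξ => Neighborhood.finite_and_eulerChar_subcomplexLE Λ (Neighborhood.incl Λ)
      (fun _ _ _ h => h.le) ξ (Neighborhood.finite_setOf_le A hA Λ hΛ ξ),
    fun φ hφ ξ => Neighborhood.finite_and_eulerChar_subcomplexLE Λ φ hφ.le_of_lt ξ
      (Neighborhood.finite_setOf_le A hA Λ hΛ ξ)⟩
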